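/- Let $\Re=\mathbb{Z}_4+v\mathbb{Z}_4=\mathbb{Z}_4[v]/\langle v^2-v\rangle$. A linear code $C$ of length $n$ over $\Re$ is an $\Re$-submodule of $\Re^n$; it is cyclic if it is closed under the cyclic shift. Its hull is $\mathrm{Hull}(C)=C\cap C^{\perp}$, where $C^{\perp}$ is the dual with respect to $h\cdot k=\sum_{i=0}^{n-1}h_ik_i$. A code has type $4^{k_1}2^{k_2}$ if it is isomorphic, as a $\mathbb{Z}_4$-module, to $\mathbb{Z}_4^{k_1}\times\mathbb{Z}_2^{k_2}$. Let $N_2=\{l\ge 1 : l \text{ divides } 2^i+1 \text{ for some positive integer } i\}$; for odd $j\ge 1$ let $\mathrm{ord}_j(2)$ be the multiplicative order of $2$ modulo $j$ and $\gamma(j)=\phi(j)/\mathrm{ord}_j(2)$, where $\phi$ is Euler's function. Let $n$ be odd with $n\in N_2$. Then the types of the hulls of the cyclic codes of length $n$ over $\Re$ are exactly $4^{0}2^{k_2}$ with $$k_2=\sum_{j\mid n,\ j\in N_2}\mathrm{ord}_j(2)\,b_{1j}+\sum_{j\mid n,\ j\in N_2}\mathrm{ord}_j(2)\,b_{2j},\qquad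 0\le b_{1j},b_{2j}\le\gamma(j),$$ where the $b_{1j},b_{2j}$ are integers. That is, the hull of every cyclic code of length $n$ over $\Re$ has such a type (in particular, no factor $\mathbb{Z}_4$), and for every such choice of integers $b_{1j},b_{2j}$ there is a cyclic code of length $n$ over $\Re$ whose hull has this type. -/

import Mathlib

namespace HullCodes

/-- The ring `ℤ₄ + vℤ₄ = ℤ₄[v]/⟨v² - v⟩`: elements `a + b v` with `a, b ∈ ℤ₄`, multiplied by the
rule `v² = 0 + 1 * v`. -/
abbrev Z4v : Type := QuadraticAlgebra (ZMod 4) 0 1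

/-- Sanity check: the adjoined element satisfies `v² = v`. -/
theorem v_mul_v : (⟨0, 1⟩ : Z4v) * ⟨0, 1⟩ = ⟨0, 1⟩ := by
  ext <;> simp

/-- A linear code of length `n` over `ℤ₄ + vℤ₄`: a submodule of the space of `n`-tuples. -/
abbrev LinearCode (n : ℕ) : Type := Submodule Z4v (Fin n → Z4v)

/-- The cyclic shift `(c₀, c₁, …, cₙ₋₁) ↦ (cₙ₋₁, c₀, …, cₙ₋₂)`. -/
def cyclicShift {n : ℕ} (c : Fin n → Z4v) : Fin n → Z4v :=
  fun i => c ((finRotate n).symm i)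

/-- A linear code is cyclic if it is closed under the cyclic shift. -/
def IsCyclicCode {n : ℕ} (C : LinearCode n) : Prop :=
  ∀ c ∈ C, cyclicShift c ∈ C

/-- The dual code for the inner product `h · k = h₀k₀ + ⋯ + hₙ₋₁kₙ₋₁`. -/
def dualCode {n : ℕ} (C : LinearCode n) : LinearCode n where
  carrier := {h | ∀ k ∈ C, ∑ i, h i * k i = 0}
  zero_mem' := by
    intro k _
    simp
  add_mem' := by
    intro a b ha hb k hk
    simp [add_mul, Finset.sum_add_distrib, ha k hk, hb k hk]
  smul_mem' := by
    intro r a ha k hk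
    simp [mul_assoc, ← Finset.mul_sum, ha k hk]

/-- The hull `C ∩ C^⊥`. -/
def hull {n : ℕ} (C : LinearCode n) : LinearCode n := C ⊓ dualCode C

/-- A code has type `4^k₁ 2^k₂` if its underlying additive group (that is, its underlying
`ℤ₄`-module) is isomorphic to `ℤ₄^k₁ × ℤ₂^k₂`. -/
def HasType {n : ℕ} (C : LinearCode n) (k₁ k₂ : ℕ) : Prop :=
  Nonempty (C ≃+ (Fin k₁ → ZMod 4) × (Fin k₂ → ZMod 2))

/-- The set `N₂` of all `l ≥ 1` dividing `2^i + 1` for some positive integer `i`. -/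
def N₂ : Set ℕ := {l | 1 ≤ l ∧ ∃ i : ℕ, 0 < i ∧ l ∣ 2 ^ i + 1}

/-- The multiplicative order `ord_j(2)` of `2` modulo `j` (used for odd `j` only). -/
noncomputable def ordTwo (j : ℕ) : ℕ := orderOf (2 : ZMod j)

/-- `γ(j) = φ(j) / ord_j(2)`; for odd `j` the division is exact. -/
noncomputable def gam (j : ℕ) : ℕ := Nat.totient j / ordTwo j

open Classical in
/-- The sum of `ord_j(2) b_j` over the divisors `j` of `n` lying in `N₂`. -/
noncomputable def ordSum (n : ℕ) (b : ℕ → ℕ) : ℕ :=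
  ∑ j ∈ n.divisors with j ∈ N₂, ordTwo j * b j

end HullCodes

/-! ### Degrees of the divisors of `X ^ n - 1` over `𝔽₂`. -/

namespace HullCodes

section
open Polynomial UniqueFactorizationMonoid

/-! Since `n` divides some `2 ^ m + 1`, inversion of `n`-th roots of unity is a power of Frobenius.
If a binary word `a` is orthogonal to all its shifts, its polynomial `A` satisfies `A(z) A(z⁻¹) =
0`, and `A(z⁻¹) = A(z) ^ 2 ^ m`, so `A` vanishes at all `n`-th roots of unity. For odd `n` there are
`n` of them, so `a = 0` (`eq_zero_of_orthogonal_shifts`).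

A word in the hull is orthogonal to its shifts, hence reduces to `0` modulo 2 at both `v = 0` and `v
= 1`, and the hull lies in `2 (ℤ₄ + vℤ₄)ⁿ`. The idempotents `1 - v` and `v` split it into two binary
cyclic codes, so it is elementary abelian. Conversely, any code inside `2 (ℤ₄ + vℤ₄)ⁿ` is its own
hull because `2 * 2 = 0`, so every pair of binary cyclic codes occurs.

The dimensions of binary cyclic codes are the degrees of the divisors of `X ^ n - 1`. This is the
product of the `j`-th cyclotomic polynomials for `j ∣ n`, each having `γ(j)` irreducible factors of
degree `ord_j(2)`. -/

theorem mem_N₂_of_dvd {n j : ℕ} (hn : n ∈ N₂) (hj : j ∣ n) : j ∈ N₂ := by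
  obtain ⟨h1, i, hi, hd⟩ := hn
  exact ⟨Nat.pos_of_dvd_of_pos hj h1, i, hi, hj.trans hd⟩

theorem ordSum_eq {n : ℕ} (hn : n ∈ N₂) (b : ℕ → ℕ) :
    ordSum n b = ∑ j ∈ n.divisors, ordTwo j * b j := by
  classical
  rw [ordSum, Finset.filter_true_of_mem]
  exact fun j hj => mem_N₂_of_dvd hn (Nat.dvd_of_mem_divisors hj)

/-- The roots of `P` are primitive `j`-th roots of unity forming one orbit under squaring, of length
the order of 2 modulo `j`. -/
theorem natDegree_eq_ordTwo {j : ℕ} (hj : Odd j) {P : (ZMod 2)[X]}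
    (hP : P ∣ cyclotomic j (ZMod 2)) (hirr : Irreducible P) : P.natDegree = ordTwo j := by
  have hc : Nat.Coprime 2 j := Nat.coprime_two_left.mpr hj
  have h := natDegree_of_dvd_cyclotomic_of_irreducible (K := ZMod 2) (p := 2) (f := 1)
    (by simp) hc hP hirr
  rw [h, ← orderOf_units, ordTwo]
  simp

theorem natDegree_eq_ordTwo_mul_card {j : ℕ} (hj : Odd j) {g : (ZMod 2)[X]}
    (hg : g ∣ cyclotomic j (ZMod 2)) :
    g.natDegree = ordTwo j * (normalizedFactors g).card := by
  have hg0 : g ≠ 0 := ne_zero_of_dvd_ne_zero (cyclotomic_ne_zero _ _) hg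
  have h1 : g.natDegree = (normalizedFactors g).prod.natDegree :=
    natDegree_eq_of_degree_eq (degree_eq_degree_of_associated (prod_normalizedFactors hg0).symm)
  rw [h1, natDegree_multiset_prod _ (zero_notMem_normalizedFactors g),
    Multiset.map_congr rfl (g := fun _ => ordTwo j), Multiset.map_const', Multiset.sum_replicate,
    smul_eq_mul, mul_comm]
  intro P hP
  exact natDegree_eq_ordTwo hj ((dvd_of_mem_normalizedFactors hP).trans hg)
    (irreducible_of_normalized_factor P hP)

theorem ordTwo_pos {j : ℕ} (hj : Odd j) : 0 < ordTwo j := by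
  have hc : Nat.Coprime 2 j := Nat.coprime_two_left.mpr hj
  have : NeZero j := ⟨hj.pos.ne'⟩
  have h : ((ZMod.unitOfCoprime 2 hc : (ZMod j)ˣ) : ZMod j) = 2 := by simp
  rw [ordTwo, ← h, orderOf_units]
  exact orderOf_pos _

/-- The number of irreducible factors of the `j`-th cyclotomic polynomial over `𝔽₂` is `γ(j)`. -/
theorem card_normalizedFactors_cyclotomic {j : ℕ} (hj : Odd j) :
    (normalizedFactors (cyclotomic j (ZMod 2))).card = gam j := by
  have h := natDegree_eq_ordTwo_mul_card hj (dvd_refl (cyclotomic j (ZMod 2)))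
  rw [natDegree_cyclotomic] at h
  rw [gam, h, Nat.mul_div_cancel_left _ (ordTwo_pos hj)]

/-- Association cannot be improved to equality: over the empty set `g` is an arbitrary unit. -/
theorem exists_dvd_of_dvd_prod {ι M : Type*} [CommMonoid M] [DecompositionMonoid M]
    [DecidableEq ι] (s : Finset ι) (f : ι → M) :
    ∀ g, g ∣ ∏ i ∈ s, f i →
      ∃ d : ι → M, (∀ i ∈ s, d i ∣ f i) ∧ Associated (∏ i ∈ s, d i) g := by
  induction s using Finset.induction_on with
  | empty =>
    intro g hg
    exact ⟨f, by simp, by simpa [associated_one_iff_isUnit, isUnit_iff_dvd_one] using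
      (associated_one_iff_isUnit.mpr (isUnit_iff_dvd_one.mpr (by simpa using hg))).symm⟩
  | insert a s ha ih =>
    intro g hg
    rw [Finset.prod_insert ha] at hg
    obtain ⟨x, y, hx, hy, rfl⟩ := exists_dvd_and_dvd_of_dvd_mul hg
    obtain ⟨d, hd, hdy⟩ := ih y hy
    refine ⟨Function.update d a x, ?_, ?_⟩
    · intro i hi
      by_cases h : i = a
      · subst h; simpa
      · rw [Function.update_of_ne h]
        exact hd i (Finset.mem_of_mem_insert_of_ne hi h)
    · rw [Finset.prod_insert ha, Function.update_self, Finset.prod_update_of_notMem ha]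
      exact hdy.mul_left x

/-- The degrees of the divisors of `X ^ n - 1` over `𝔽₂` are of the form `∑ ord_j(2) b_j`. -/
theorem exists_natDegree_eq_ordSum {n : ℕ} (hodd : Odd n) (hn : n ∈ N₂) {g : (ZMod 2)[X]}
    (hg : g ∣ X ^ n - 1) :
    ∃ b : ℕ → ℕ, (∀ j, j ∣ n → b j ≤ gam j) ∧ g.natDegree = ordSum n b := by
  rw [← prod_cyclotomic_eq_X_pow_sub_one hodd.pos] at hg
  obtain ⟨d, hd, hdg⟩ := exists_dvd_of_dvd_prod _ _ g hg
  refine ⟨fun j => (normalizedFactors (d j)).card, ?_, ?_⟩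
  · intro j hj
    have hjo := hodd.of_dvd_nat hj
    rw [← card_normalizedFactors_cyclotomic hjo]
    have hdj := hd j (Nat.mem_divisors.mpr ⟨hj, hodd.pos.ne'⟩)
    have hc := cyclotomic_ne_zero j (ZMod 2)
    exact Multiset.card_le_card ((dvd_iff_normalizedFactors_le_normalizedFactors
      (ne_zero_of_dvd_ne_zero hc hdj) hc).mp hdj)
  · rw [ordSum_eq hn, ← natDegree_eq_of_degree_eq (degree_eq_degree_of_associated hdg),
      natDegree_prod _ _ fun j hj => ne_zero_of_dvd_ne_zero (cyclotomic_ne_zero _ _) (hd j hj)]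
    exact Finset.sum_congr rfl fun j hj => natDegree_eq_ordTwo_mul_card
      (hodd.of_dvd_nat (Nat.dvd_of_mem_divisors hj)) (hd j hj)

theorem exists_dvd_cyclotomic {j : ℕ} (hj : Odd j) {k : ℕ} (hk : k ≤ gam j) :
    ∃ g : (ZMod 2)[X], g ∣ cyclotomic j (ZMod 2) ∧ g.natDegree = ordTwo j * k := by
  rw [← card_normalizedFactors_cyclotomic hj] at hk
  -- Any `k` of the `γ(j)` irreducible factors will do, as all have the same degree.
  obtain ⟨t, ht, htk⟩ : ∃ t ≤ normalizedFactors (cyclotomic j (ZMod 2)), t.card = k := by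
    refine ⟨((normalizedFactors (cyclotomic j (ZMod 2))).toList.take k : List _), ?_, by simpa⟩
    conv_rhs => rw [← Multiset.coe_toList (normalizedFactors (cyclotomic j (ZMod 2)))]
    exact (List.take_sublist _ _).subperm
  have hc := cyclotomic_ne_zero j (ZMod 2)
  have hd : t.prod ∣ cyclotomic j (ZMod 2) :=
    (Multiset.prod_dvd_prod_of_le ht).trans (prod_normalizedFactors hc).dvd
  refine ⟨t.prod, hd, ?_⟩
  rw [natDegree_multiset_prod _ fun h => zero_notMem_normalizedFactors _ (Multiset.mem_of_le ht h),
    Multiset.map_congr rfl (g := fun _ => ordTwo j), Multiset.map_const', Multiset.sum_replicate,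
    smul_eq_mul, mul_comm, htk]
  intro P hP
  have hP' := Multiset.mem_of_le ht hP
  exact natDegree_eq_ordTwo hj (dvd_of_mem_normalizedFactors hP')
    (irreducible_of_normalized_factor P hP')

theorem exists_dvd_natDegree_eq {n : ℕ} (hodd : Odd n) (hn : n ∈ N₂) {b : ℕ → ℕ}
    (hb : ∀ j, j ∣ n → b j ≤ gam j) :
    ∃ g : (ZMod 2)[X], g ∣ X ^ n - 1 ∧ g.natDegree = ordSum n b := by
  have h : ∀ j, ∃ g : (ZMod 2)[X], j ∈ n.divisors →
      g ∣ cyclotomic j (ZMod 2) ∧ g.natDegree = ordTwo j * b j := by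
    intro j
    by_cases hj : j ∈ n.divisors
    · have hj' := Nat.dvd_of_mem_divisors hj
      obtain ⟨g, hg⟩ := exists_dvd_cyclotomic (hodd.of_dvd_nat hj') (hb j hj')
      exact ⟨g, fun _ => hg⟩
    · exact ⟨0, fun h => absurd h hj⟩
  choose g hg using h
  refine ⟨∏ j ∈ n.divisors, g j, ?_, ?_⟩
  · rw [← prod_cyclotomic_eq_X_pow_sub_one hodd.pos]
    exact Finset.prod_dvd_prod_of_dvd _ _ fun j hj => (hg j hj).1
  · rw [ordSum_eq hn, natDegree_prod _ _ fun j hj =>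
      ne_zero_of_dvd_ne_zero (cyclotomic_ne_zero _ _) (hg j hj).1]
    exact Finset.sum_congr rfl fun j hj => (hg j hj).2

end

end HullCodes

/-! ### Binary cyclic codes as ideals of `𝔽₂[X]` containing `X ^ n - 1`. -/

namespace HullCodes

section
open Polynomial
open scoped Fin.CommRing

/-- The cyclic shift of binary words, as a linear map. -/
def binaryShift (n : ℕ) : Module.End (ZMod 2) (Fin n → ZMod 2) :=
  LinearMap.funLeft (ZMod 2) (ZMod 2) (finRotate n).symm

/-- The binary word with the coefficients of a polynomial modulo `X ^ n - 1`. -/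
noncomputable def polyWord (n : ℕ) [NeZero n] : (ZMod 2)[X] →ₗ[ZMod 2] (Fin n → ZMod 2) :=
  LinearMap.applyₗ (Pi.single (0 : Fin n) (1 : ZMod 2)) ∘ₗ (aeval (binaryShift n)).toLinearMap

variable {n : ℕ} [NeZero n]

theorem polyWord_apply (p : (ZMod 2)[X]) :
    polyWord n p = aeval (binaryShift n) p (Pi.single (0 : Fin n) (1 : ZMod 2)) := rfl

theorem polyWord_mul (p q : (ZMod 2)[X]) :
    polyWord n (p * q) = aeval (binaryShift n) p (polyWord n q) := by
  simp [polyWord_apply]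

theorem binaryShift_pow_apply (k : ℕ) (a : Fin n → ZMod 2) (i : Fin n) :
    (binaryShift n ^ k) a i = a (i - (k : Fin n)) := by
  induction k generalizing a with
  | zero => simp
  | succ k ih =>
    rw [pow_succ, Module.End.mul_apply, ih, binaryShift, LinearMap.funLeft_apply,
      finRotate_symm_apply, Nat.cast_succ, sub_sub]

theorem polyWord_X_pow (k : ℕ) : polyWord n (X ^ k) = Pi.single (k : Fin n) 1 := by
  ext i
  rw [polyWord_apply, map_pow, aeval_X, binaryShift_pow_apply, Pi.single_apply, Pi.single_apply]
  simp only [sub_eq_zero]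

theorem polyWord_surjective : Function.Surjective (polyWord n) := by
  rw [← LinearMap.range_eq_top, eq_top_iff, ← (Pi.basisFun (ZMod 2) (Fin n)).span_eq,
    Submodule.span_le]
  rintro _ ⟨i, rfl⟩
  exact ⟨X ^ (i : ℕ), by simp [polyWord_X_pow]⟩

theorem aeval_binaryShift_X_pow_sub_one : aeval (binaryShift n) (X ^ n - 1 : (ZMod 2)[X]) = 0 := by
  ext1 a
  ext i
  simp [binaryShift_pow_apply]

omit [NeZero n] in
theorem aeval_mem_of_shift_mem {D : Submodule (ZMod 2) (Fin n → ZMod 2)}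
    (hD : ∀ c ∈ D, binaryShift n c ∈ D) (p : (ZMod 2)[X]) {c : Fin n → ZMod 2} (hc : c ∈ D) :
    aeval (binaryShift n) p c ∈ D := by
  induction p using Polynomial.induction_on' with
  | add p q hp hq => simpa using D.add_mem hp hq
  | monomial k r =>
    rw [aeval_monomial, Module.End.mul_apply, Module.algebraMap_end_apply]
    refine D.smul_mem _ ?_
    induction k with
    | zero => simpa
    | succ k ih => rw [pow_succ', Module.End.mul_apply]; exact hD _ ih

/-- The ideal of polynomials representing the words of a binary cyclic code. -/
noncomputable def codeIdeal (D : Submodule (ZMod 2) (Fin n → ZMod 2))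
    (hD : ∀ c ∈ D, binaryShift n c ∈ D) : Ideal (ZMod 2)[X] where
  __ := (D.comap (polyWord n)).toAddSubmonoid
  smul_mem' p q hq := by
    change polyWord n (p * q) ∈ D
    rw [polyWord_mul]
    exact aeval_mem_of_shift_mem hD p hq

theorem mem_codeIdeal {D : Submodule (ZMod 2) (Fin n → ZMod 2)}
    {hD : ∀ c ∈ D, binaryShift n c ∈ D} {p : (ZMod 2)[X]} :
    p ∈ codeIdeal D hD ↔ polyWord n p ∈ D := Iff.rfl

/-- `polyWord` identifies `𝔽₂[X] / (f)` with the quotient of the whole space by `D`. -/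
theorem finrank_add_natDegree {D : Submodule (ZMod 2) (Fin n → ZMod 2)}
    {hD : ∀ c ∈ D, binaryShift n c ∈ D} {f : (ZMod 2)[X]} (hf : codeIdeal D hD = Ideal.span {f}) :
    Module.finrank (ZMod 2) D + f.natDegree = n := by
  have hs : Function.Surjective (D.mkQ ∘ₗ polyWord n) :=
    D.mkQ_surjective.comp polyWord_surjective
  have hk : LinearMap.ker (D.mkQ ∘ₗ polyWord n) = (Ideal.span {f}).restrictScalars (ZMod 2) := by
    ext p
    rw [Submodule.restrictScalars_mem, ← hf, mem_codeIdeal]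
    simp
  have e := (Submodule.quotEquivOfEq _ _ hk).symm.trans
    (LinearMap.quotKerEquivOfSurjective _ hs)
  have h1 := e.finrank_eq
  have h2 : Module.finrank (ZMod 2) ((ZMod 2)[X] ⧸ (Ideal.span {f}).restrictScalars (ZMod 2)) =
    f.natDegree := finrank_quotient_span_eq_natDegree
  have h3 := D.finrank_quotient_add_finrank
  rw [Module.finrank_fin_fun] at h3
  lia

theorem X_pow_sub_one_mem_codeIdeal (D : Submodule (ZMod 2) (Fin n → ZMod 2))
    (hD : ∀ c ∈ D, binaryShift n c ∈ D) : (X ^ n - 1 : (ZMod 2)[X]) ∈ codeIdeal D hD := by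
  rw [mem_codeIdeal, polyWord_apply, aeval_binaryShift_X_pow_sub_one]
  simp

/-- The dimension of a binary cyclic code is the degree of its check polynomial. -/
theorem exists_dvd_finrank_eq (D : Submodule (ZMod 2) (Fin n → ZMod 2))
    (hD : ∀ c ∈ D, binaryShift n c ∈ D) :
    ∃ g : (ZMod 2)[X], g ∣ X ^ n - 1 ∧ Module.finrank (ZMod 2) D = g.natDegree := by
  obtain ⟨f, hf⟩ := IsPrincipalIdealRing.principal (codeIdeal D hD)
  have hmem := X_pow_sub_one_mem_codeIdeal D hD
  rw [hf] at hmem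
  obtain ⟨g, hg⟩ := Ideal.mem_span_singleton.mp hmem
  refine ⟨g, ⟨f, by rw [hg, mul_comm]⟩, ?_⟩
  have h0 : (X ^ n - 1 : (ZMod 2)[X]) ≠ 0 := X_pow_sub_C_ne_zero (NeZero.pos n) 1
  have h1 := finrank_add_natDegree hf
  have h2 : (X ^ n - 1 : (ZMod 2)[X]).natDegree = n := natDegree_X_pow_sub_C (r := 1)
  rw [hg, natDegree_mul (fun h => h0 (by rw [hg, h, zero_mul]))
    (fun h => h0 (by rw [hg, h, mul_zero]))] at h2
  lia

/-- The kernel is the ideal of the zero code. Its generator divides `X ^ n - 1` and has degree `n`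
by the dimension count, so the two are associated. -/
theorem polyWord_eq_zero_iff {p : (ZMod 2)[X]} : polyWord n p = 0 ↔ X ^ n - 1 ∣ p := by
  have hD : ∀ c ∈ (⊥ : Submodule (ZMod 2) (Fin n → ZMod 2)), binaryShift n c ∈
      (⊥ : Submodule (ZMod 2) (Fin n → ZMod 2)) := by simp
  obtain ⟨f, hf⟩ := IsPrincipalIdealRing.principal (codeIdeal ⊥ hD)
  have hmem := X_pow_sub_one_mem_codeIdeal ⊥ hD
  rw [hf] at hmem
  have hdvd := Ideal.mem_span_singleton.mp hmem
  have h1 := finrank_add_natDegree hf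
  have h2 : (X ^ n - 1 : (ZMod 2)[X]).natDegree = n := natDegree_X_pow_sub_C (r := 1)
  have h0 : (X ^ n - 1 : (ZMod 2)[X]) ≠ 0 := X_pow_sub_C_ne_zero (NeZero.pos n) 1
  rw [finrank_bot, zero_add] at h1
  have ha : Associated f (X ^ n - 1) := associated_of_dvd_of_natDegree_le hdvd h0 (by lia)
  rw [← ha.dvd_iff_dvd_left, ← Ideal.mem_span_singleton]
  have h3 : p ∈ codeIdeal ⊥ hD ↔ p ∈ Ideal.span {f} := by rw [hf]
  rw [← h3, mem_codeIdeal, Submodule.mem_bot]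

theorem exists_cyclic_finrank_eq {g : (ZMod 2)[X]} (hg : g ∣ X ^ n - 1) :
    ∃ D : Submodule (ZMod 2) (Fin n → ZMod 2), (∀ c ∈ D, binaryShift n c ∈ D) ∧
      Module.finrank (ZMod 2) D = g.natDegree := by
  obtain ⟨f, hf⟩ := hg
  -- The generator is the cofactor `f`, so that the dimension `n - deg f` equals `deg g`.
  let D : Submodule (ZMod 2) (Fin n → ZMod 2) :=
    ((Ideal.span {f}).restrictScalars (ZMod 2)).map (polyWord n)
  have hD : ∀ c ∈ D, binaryShift n c ∈ D := by
    rintro _ ⟨p, hp, rfl⟩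
    refine ⟨X * p, Ideal.mul_mem_left _ _ hp, ?_⟩
    rw [polyWord_mul, aeval_X]
  refine ⟨D, hD, ?_⟩
  have hI : codeIdeal D hD = Ideal.span {f} := by
    ext p
    rw [mem_codeIdeal]
    constructor
    · rintro ⟨q, hq, hqp⟩
      rw [← sub_eq_zero, ← map_sub, polyWord_eq_zero_iff, hf] at hqp
      have hq' := Ideal.mem_span_singleton.mp hq
      rw [Ideal.mem_span_singleton]
      exact (dvd_sub_right hq').mp ((dvd_mul_left f g).trans hqp)
    · exact fun hp => ⟨p, hp, rfl⟩
  have h0 : (X ^ n - 1 : (ZMod 2)[X]) ≠ 0 := X_pow_sub_C_ne_zero (NeZero.pos n) 1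
  have h1 := finrank_add_natDegree hI
  have h2 : (X ^ n - 1 : (ZMod 2)[X]).natDegree = n := natDegree_X_pow_sub_C (r := 1)
  rw [hf, natDegree_mul (fun h => h0 (by rw [hf, h, zero_mul]))
    (fun h => h0 (by rw [hf, h, mul_zero]))] at h2
  lia

end

end HullCodes

/-! ### Vanishing of binary words orthogonal to their shifts. -/

namespace HullCodes

section
open Polynomial
open scoped Fin.CommRing
variable {n : ℕ} [NeZero n]

omit [NeZero n] in
theorem pow_fin_add {M : Type*} [Monoid M] {z : M} (hz : z ^ n = 1) (x y : Fin n) :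
    z ^ ((x + y : Fin n) : ℕ) = z ^ (x : ℕ) * z ^ (y : ℕ) := by
  rw [Fin.val_add, ← pow_eq_pow_mod _ hz, pow_add]

/-- A binary word orthogonal to all its cyclic shifts has no nonzero Fourier coefficient when `-1`
is a power of `2` modulo the length. -/
theorem sum_mul_pow_eq_zero {K : Type*} [Field K] [CharP K 2] {z : K} (hz : z ^ n = 1) {m : ℕ}
    (hm : n ∣ 2 ^ m + 1) {f : ZMod 2 →+* K} {a : Fin n → ZMod 2}
    (h : ∀ k : Fin n, ∑ i, a i * a (i - k) = 0) : ∑ i, f (a i) * z ^ (i : ℕ) = 0 := by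
  set w := z ^ 2 ^ m with hw
  have hzw : z * w = 1 := by
    obtain ⟨q, hq⟩ := hm
    rw [hw, ← pow_succ', hq, pow_mul, hz, one_pow]
  -- The coefficients lie in `𝔽₂`, so Frobenius moves only the powers of `z`.
  have hfrob : (∑ i, f (a i) * z ^ (i : ℕ)) ^ 2 ^ m = ∑ i, f (a i) * w ^ (i : ℕ) := by
    rw [sum_pow_char_pow]
    refine Finset.sum_congr rfl fun i _ => ?_
    rw [mul_pow, ← map_pow, ZMod.pow_card_pow, hw, pow_right_comm]
  have hprod : (∑ i, f (a i) * z ^ (i : ℕ)) * ∑ i, f (a i) * w ^ (i : ℕ) = 0 := by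
    rw [Finset.sum_mul_sum]
    calc ∑ i, ∑ j, f (a i) * z ^ (i : ℕ) * (f (a j) * w ^ (j : ℕ))
        = ∑ i, ∑ k, f (a i * a (i - k)) * z ^ (k : ℕ) := by
          refine Finset.sum_congr rfl fun i _ => ?_
          -- Substitute `j = i - k`: since `w` is the inverse of `z`, the term depends on the
          -- exponents only through `z ^ k`, and the sum over `i` is a correlation.
          rw [← (Equiv.subLeft i).sum_comp]
          refine Finset.sum_congr rfl fun k _ => ?_
          have h1 : z ^ (i : ℕ) = z ^ ((i - k : Fin n) : ℕ) * z ^ (k : ℕ) := by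
            rw [← pow_fin_add hz, sub_add_cancel]
          have h2 : z ^ ((i - k : Fin n) : ℕ) * w ^ ((i - k : Fin n) : ℕ) = 1 := by
            rw [← mul_pow, hzw, one_pow]
          rw [Equiv.subLeft_apply, h1, map_mul]
          linear_combination f (a i) * f (a (i - k)) * z ^ (k : ℕ) * h2
      _ = ∑ k, f (∑ i, a i * a (i - k)) * z ^ (k : ℕ) := by
          rw [Finset.sum_comm]
          refine Finset.sum_congr rfl fun k _ => ?_
          rw [map_sum, Finset.sum_mul]
      _ = 0 := by simp [h]
  rw [← hfrob, ← pow_succ'] at hprod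
  exact eq_zero_of_pow_eq_zero hprod

theorem eq_zero_of_orthogonal_shifts (hodd : Odd n) (hn : n ∈ N₂) {a : Fin n → ZMod 2}
    (h : ∀ k : Fin n, ∑ i, a i * a (i - k) = 0) : a = 0 := by
  obtain ⟨-, m, -, hm⟩ := hn
  let K := AlgebraicClosure (ZMod 2)
  -- Oddness of `n` makes the `n`-th roots of unity in `K` distinct, enough to kill a polynomial of
  -- degree below `n`.
  have : NeZero (n : K) := ⟨by
    rw [Ne, CharP.cast_eq_zero_iff K 2, ← even_iff_two_dvd]
    exact Nat.not_even_iff_odd.mpr hodd⟩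
  obtain ⟨z, hz⟩ := HasEnoughRootsOfUnity.exists_primitiveRoot K n
  let A : K[X] := ∑ i : Fin n, C (algebraMap (ZMod 2) K (a i)) * X ^ (i : ℕ)
  have hA : A = 0 := by
    refine Polynomial.eq_zero_of_natDegree_lt_card_of_eval_eq_zero A
      (f := fun i : Fin n => z ^ (i : ℕ)) ?_ ?_ ?_
    · exact fun i j hij => Fin.ext (hz.pow_inj i.2 j.2 hij)
    · intro i
      have hzi : (z ^ (i : ℕ)) ^ n = 1 := by rw [pow_right_comm, hz.pow_eq_one, one_pow]
      simpa [A, eval_finsetSum] using sum_mul_pow_eq_zero hzi hm (f := algebraMap (ZMod 2) K) h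
    · rw [Fintype.card_fin]
      refine Nat.lt_of_le_pred (NeZero.pos n) (natDegree_sum_le_of_forall_le _ _ fun i _ => ?_)
      exact (natDegree_C_mul_X_pow_le _ _).trans (Nat.le_pred_of_lt i.2)
  ext i
  have hc : A.coeff i = algebraMap (ZMod 2) K (a i) := by
    simp [A, coeff_C_mul, coeff_X_pow, Fin.val_inj]
  rw [hA, coeff_zero] at hc
  exact (map_eq_zero _).mp hc.symm

end

end HullCodes

/-! ### Splitting `2 (ℤ₄ + vℤ₄)ⁿ` into two binary components. -/

namespace HullCodes

section
open scoped Fin.CommRing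

/-- Reduction of `ℤ₄` modulo `2`. -/
abbrev modTwo : ZMod 4 →+* ZMod 2 := ZMod.castHom (by norm_num : 2 ∣ 4) (ZMod 2)

/-- The embedding of `ℤ₂` in `ℤ₄` with image `{0, 2}`. -/
def double (x : ZMod 2) : ZMod 4 := 2 * (x.val : ZMod 4)

theorem double_add : ∀ x y, double (x + y) = double x + double y := by decide

theorem double_injective : Function.Injective double := by decide

theorem double_mul_double : ∀ x y, double x * double y = 0 := by decide

theorem double_mul_two : ∀ x, double x * 2 = 0 := by decide

theorem mul_double : ∀ r x, r * double x = double (modTwo r * x) := by decide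

theorem exists_double_eq : ∀ c, modTwo c = 0 → ∃ x, double x = c := by decide

/-- The reduction of `ℤ₄ + vℤ₄` to `𝔽₂` sending `v` to `0`. -/
def evalZero : Z4v →+* ZMod 2 where
  toFun r := modTwo r.re
  map_zero' := by simp
  map_one' := rfl
  map_add' r s := by simp
  map_mul' r s := by simp

/-- The reduction of `ℤ₄ + vℤ₄` to `𝔽₂` sending `v` to `1`. -/
def evalOne : Z4v →+* ZMod 2 where
  toFun r := modTwo (r.re + r.im)
  map_zero' := by simp
  map_one' := rfl
  map_add' r s := by simp only [QuadraticAlgebra.re_add, QuadraticAlgebra.im_add, map_add]; ring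
  map_mul' r s := by
    simp only [QuadraticAlgebra.re_mul, QuadraticAlgebra.im_mul, ← map_mul]
    congr 1
    ring

theorem evalZero_apply (r : Z4v) : evalZero r = modTwo r.re := rfl

theorem evalOne_apply (r : Z4v) : evalOne r = modTwo (r.re + r.im) := rfl

variable {n : ℕ}

/-- The word of `2 (ℤ₄ + vℤ₄)ⁿ` with components `x` at `v = 0` and `y` at `v = 1`. -/
def glue (n : ℕ) : (Fin n → ZMod 2) × (Fin n → ZMod 2) →+ (Fin n → Z4v) where
  toFun p i := ⟨double (p.1 i), double (p.1 i + p.2 i)⟩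
  map_zero' := by ext i <;> simp [double]
  map_add' p q := by
    ext i
    · simp [double_add]
    · simp only [Prod.fst_add, Prod.snd_add, Pi.add_apply, QuadraticAlgebra.im_add, double_add]
      ring

theorem glue_apply (p : (Fin n → ZMod 2) × (Fin n → ZMod 2)) (i : Fin n) :
    glue n p i = ⟨double (p.1 i), double (p.1 i + p.2 i)⟩ := rfl

theorem glue_injective : Function.Injective (glue n) := by
  intro p q h
  have h1 : p.1 = q.1 := funext fun i =>
    double_injective (congrArg QuadraticAlgebra.re (congrFun h i))
  have h2 : p.1 + p.2 = q.1 + q.2 := funext fun i =>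
    double_injective (congrArg QuadraticAlgebra.im (congrFun h i))
  exact Prod.ext h1 (by rwa [h1, add_right_inj] at h2)

/-- The values of `glue n (x, y)` at `v = 0` and `v = 1` are `2x` and `4x + 2y = 2y`. Evaluation is
multiplicative, and a scalar acts on doubled words only through its residue modulo 2. -/
theorem smul_glue (r : Z4v) (x y : Fin n → ZMod 2) :
    r • glue n (x, y) = glue n (evalZero r • x, evalOne r • y) := by
  ext i
  · simp [glue_apply, evalZero_apply, mul_double]
  · simp [glue_apply, evalZero_apply, evalOne_apply, mul_double, mul_add, add_mul, double_add]
    linear_combination double_mul_two (r.im.cast * x i)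

theorem glue_mul_glue (p q : (Fin n → ZMod 2) × (Fin n → ZMod 2)) (i : Fin n) :
    glue n p i * glue n q i = 0 := by
  ext <;> simp [glue_apply, double_mul_double]

theorem cyclicShift_glue (x y : Fin n → ZMod 2) :
    cyclicShift (glue n (x, y)) = glue n (binaryShift n x, binaryShift n y) := rfl

theorem exists_glue_eq {c : Fin n → Z4v} (h0 : ∀ i, evalZero (c i) = 0)
    (h1 : ∀ i, evalOne (c i) = 0) : ∃ x y, glue n (x, y) = c := by
  choose x hx using fun i => exists_double_eq _ (h0 i)
  choose y hy using fun i => exists_double_eq (c i).im (by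
    have := h1 i
    rwa [evalOne_apply, map_add, ← evalZero_apply, h0 i, zero_add] at this)
  -- Here `y` halves the coefficient of `v`, where `glue` stores the sum of its two components.
  refine ⟨x, y - x, ?_⟩
  ext i
  · exact hx i
  · simpa [glue_apply] using hy i

theorem hasType_of_mem_iff {H : LinearCode n} {D₁ D₂ : Submodule (ZMod 2) (Fin n → ZMod 2)}
    (hH : ∀ c, c ∈ H ↔ ∃ x ∈ D₁, ∃ y ∈ D₂, glue n (x, y) = c) :
    HasType H 0 (Module.finrank (ZMod 2) D₁ + Module.finrank (ZMod 2) D₂) := by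
  let f : D₁ × D₂ →+ H :=
    ((glue n).comp (D₁.subtype.prodMap D₂.subtype).toAddMonoidHom).codRestrict H fun p =>
      (hH _).mpr ⟨p.1, p.1.2, p.2, p.2.2, rfl⟩
  have hf : Function.Bijective f := by
    constructor
    · intro p q hpq
      have h := glue_injective (congrArg Subtype.val hpq)
      exact Prod.ext (Subtype.ext (congrArg Prod.fst h)) (Subtype.ext (congrArg Prod.snd h))
    · rintro ⟨c, hc⟩
      obtain ⟨x, hx, y, hy, rfl⟩ := (hH c).mp hc
      exact ⟨(⟨x, hx⟩, ⟨y, hy⟩), rfl⟩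
  have e : (D₁ × D₂) ≃ₗ[ZMod 2] (Fin (Module.finrank (ZMod 2) D₁ + Module.finrank (ZMod 2) D₂) →
      ZMod 2) := LinearEquiv.ofFinrankEq _ _ (by simp)
  exact ⟨((AddEquiv.ofBijective f hf).symm.trans e.toAddEquiv).trans
    AddEquiv.uniqueProd.symm⟩

/-! ### Hulls of cyclic codes and their types. -/

theorem cyclicShift_iterate [NeZero n] (k : ℕ) (c : Fin n → Z4v) (i : Fin n) :
    cyclicShift^[k] c i = c (i - (k : Fin n)) := by
  induction k generalizing c with
  | zero => simp
  | succ k ih =>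
    rw [Function.iterate_succ_apply, ih, cyclicShift, finRotate_symm_apply, Nat.cast_succ, sub_sub]

theorem IsCyclicCode.iterate_mem {C : LinearCode n} (hC : IsCyclicCode C) (k : ℕ)
    {c : Fin n → Z4v} (hc : c ∈ C) : cyclicShift^[k] c ∈ C := by
  induction k with
  | zero => exact hc
  | succ k ih => rw [Function.iterate_succ_apply']; exact hC _ ih

theorem IsCyclicCode.dualCode [NeZero n] {C : LinearCode n} (hC : IsCyclicCode C) :
    IsCyclicCode (dualCode C) := by
  intro h hh k hk
  -- The `(n - 1)`-fold shift is the inverse shift; moving it onto `k` leaves the inner product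
  -- unchanged.
  have h1 := hh _ (hC.iterate_mem (n - 1) hk)
  rw [← h1, ← Equiv.sum_comp (finRotate n)]
  refine Finset.sum_congr rfl fun i _ => ?_
  have h2 : ((n - 1 : ℕ) : Fin n) = -1 := by
    rw [Nat.cast_sub (NeZero.one_le), Fin.natCast_self]
    simp
  rw [cyclicShift, Equiv.symm_apply_apply, cyclicShift_iterate, h2, sub_neg_eq_add,
    finRotate_apply]

theorem IsCyclicCode.hull [NeZero n] {C : LinearCode n} (hC : IsCyclicCode C) :
    IsCyclicCode (hull C) :=
  fun c hc => ⟨hC c hc.1, hC.dualCode c hc.2⟩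

/-- The shifts of `h` lie in `C` while `h` lies in the dual, so `h` is orthogonal to its shifts, and
so is its image under any ring homomorphism. -/
theorem eval_eq_zero_of_mem_hull [NeZero n] (hodd : Odd n) (hn : n ∈ N₂) {C : LinearCode n}
    (hC : IsCyclicCode C) {h : Fin n → Z4v} (hh : h ∈ hull C) (f : Z4v →+* ZMod 2) (i : Fin n) :
    f (h i) = 0 := by
  refine congrFun (eq_zero_of_orthogonal_shifts hodd hn (a := fun i => f (h i)) fun k => ?_) i
  have h1 := congrArg f (hh.2 _ (hC.iterate_mem k hh.1))
  simpa [cyclicShift_iterate] using h1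

/-- The binary words embedded in a code by a component of `glue`. -/
def component (H : LinearCode n)
    (g : (Fin n → ZMod 2) →+ (Fin n → ZMod 2) × (Fin n → ZMod 2)) :
    Submodule (ZMod 2) (Fin n → ZMod 2) :=
  AddSubgroup.toZModSubmodule 2 (H.toAddSubgroup.comap ((glue n).comp g))

theorem mem_component {H : LinearCode n}
    {g : (Fin n → ZMod 2) →+ (Fin n → ZMod 2) × (Fin n → ZMod 2)} {x : Fin n → ZMod 2} :
    x ∈ component H g ↔ glue n (g x) ∈ H := Iff.rfl

theorem exists_hasType_hull (hodd : Odd n) (hn : n ∈ N₂) {C : LinearCode n}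
    (hC : IsCyclicCode C) :
    ∃ b₁ b₂ : ℕ → ℕ, (∀ j, j ∣ n → b₁ j ≤ gam j ∧ b₂ j ≤ gam j) ∧
      HasType (hull C) 0 (ordSum n b₁ + ordSum n b₂) := by
  have : NeZero n := ⟨hodd.pos.ne'⟩
  have hcyc := hC.hull
  let D₁ := component (hull C) (AddMonoidHom.inl _ _)
  let D₂ := component (hull C) (AddMonoidHom.inr _ _)
  have hD₁ : ∀ c ∈ D₁, binaryShift n c ∈ D₁ := fun c hc => by
    have h := hcyc _ hc
    rwa [AddMonoidHom.comp_apply, AddMonoidHom.inl_apply, cyclicShift_glue, map_zero] at h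
  have hD₂ : ∀ c ∈ D₂, binaryShift n c ∈ D₂ := fun c hc => by
    have h := hcyc _ hc
    rwa [AddMonoidHom.comp_apply, AddMonoidHom.inr_apply, cyclicShift_glue, map_zero] at h
  have hH : ∀ c, c ∈ hull C ↔ ∃ x ∈ D₁, ∃ y ∈ D₂, glue n (x, y) = c := by
    intro c
    constructor
    · intro hc
      obtain ⟨x, y, rfl⟩ := exists_glue_eq (eval_eq_zero_of_mem_hull hodd hn hC hc evalZero)
        (eval_eq_zero_of_mem_hull hodd hn hC hc evalOne)
      refine ⟨x, ?_, y, ?_, rfl⟩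
      -- The idempotent `1 - v` keeps the component at `v = 0` and kills the other; `v` does the
      -- opposite.
      · have h := (hull C).smul_mem ⟨1, -1⟩ hc
        rw [smul_glue] at h
        simpa [evalZero_apply, evalOne_apply, D₁, mem_component] using h
      · have h := (hull C).smul_mem ⟨0, 1⟩ hc
        rw [smul_glue] at h
        simpa [evalZero_apply, evalOne_apply, D₂, mem_component] using h
    · rintro ⟨x, hx, y, hy, rfl⟩
      have h := (hull C).add_mem (mem_component.mp hx) (mem_component.mp hy)
      rw [← map_add] at h
      simpa using h
  obtain ⟨g₁, hg₁, hr₁⟩ := exists_dvd_finrank_eq D₁ hD₁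
  obtain ⟨g₂, hg₂, hr₂⟩ := exists_dvd_finrank_eq D₂ hD₂
  obtain ⟨b₁, hb₁, hs₁⟩ := exists_natDegree_eq_ordSum hodd hn hg₁
  obtain ⟨b₂, hb₂, hs₂⟩ := exists_natDegree_eq_ordSum hodd hn hg₂
  refine ⟨b₁, b₂, fun j hj => ⟨hb₁ j hj, hb₂ j hj⟩, ?_⟩
  rw [← hs₁, ← hs₂, ← hr₁, ← hr₂]
  exact hasType_of_mem_iff hH

/-- The code in `2 (ℤ₄ + vℤ₄)ⁿ` with given binary components. -/
def glueCode (D₁ D₂ : Submodule (ZMod 2) (Fin n → ZMod 2)) : LinearCode n where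
  __ := ((D₁.prod D₂).toAddSubmonoid.map (glue n))
  smul_mem' := by
    rintro r _ ⟨⟨x, y⟩, ⟨hx, hy⟩, rfl⟩
    exact ⟨_, ⟨D₁.smul_mem _ hx, D₂.smul_mem _ hy⟩, (smul_glue r x y).symm⟩

theorem mem_glueCode {D₁ D₂ : Submodule (ZMod 2) (Fin n → ZMod 2)} {c : Fin n → Z4v} :
    c ∈ glueCode D₁ D₂ ↔ ∃ x ∈ D₁, ∃ y ∈ D₂, glue n (x, y) = c := by
  constructor
  · rintro ⟨⟨x, y⟩, ⟨hx, hy⟩, h⟩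
    exact ⟨x, hx, y, hy, h⟩
  · rintro ⟨x, hx, y, hy, h⟩
    exact ⟨(x, y), ⟨hx, hy⟩, h⟩

/-- All entries are multiples of 2, so all products vanish and the code is self-orthogonal. -/
theorem hull_glueCode (D₁ D₂ : Submodule (ZMod 2) (Fin n → ZMod 2)) :
    hull (glueCode D₁ D₂) = glueCode D₁ D₂ := by
  refine inf_eq_left.mpr ?_
  rintro _ ⟨p, -, rfl⟩ _ ⟨q, -, rfl⟩
  exact Finset.sum_eq_zero fun i _ => glue_mul_glue p q i

theorem exists_isCyclicCode_hasType_hull (hodd : Odd n) (hn : n ∈ N₂) {b₁ b₂ : ℕ → ℕ}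
    (hb₁ : ∀ j, j ∣ n → b₁ j ≤ gam j) (hb₂ : ∀ j, j ∣ n → b₂ j ≤ gam j) :
    ∃ C : LinearCode n, IsCyclicCode C ∧ HasType (hull C) 0 (ordSum n b₁ + ordSum n b₂) := by
  have : NeZero n := ⟨hodd.pos.ne'⟩
  obtain ⟨g₁, hg₁, hs₁⟩ := exists_dvd_natDegree_eq hodd hn hb₁
  obtain ⟨g₂, hg₂, hs₂⟩ := exists_dvd_natDegree_eq hodd hn hb₂
  obtain ⟨D₁, hD₁, hr₁⟩ := exists_cyclic_finrank_eq hg₁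
  obtain ⟨D₂, hD₂, hr₂⟩ := exists_cyclic_finrank_eq hg₂
  refine ⟨glueCode D₁ D₂, ?_, ?_⟩
  · rintro _ ⟨⟨x, y⟩, ⟨hx, hy⟩, rfl⟩
    exact ⟨_, ⟨hD₁ x hx, hD₂ y hy⟩, (cyclicShift_glue x y).symm⟩
  · rw [hull_glueCode, ← hs₁, ← hs₂, ← hr₁, ← hr₂]
    exact hasType_of_mem_iff fun c => mem_glueCode

end

end HullCodes

theorem corollary4p3 (n : ℕ) (hodd : Odd n) (hn : n ∈ HullCodes.N₂) :
    (∀ C : HullCodes.LinearCode n, HullCodes.IsCyclicCode C →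
      ∃ b₁ b₂ : ℕ → ℕ,
        (∀ j, j ∣ n → j ∈ HullCodes.N₂ → b₁ j ≤ HullCodes.gam j ∧ b₂ j ≤ HullCodes.gam j) ∧
        HullCodes.HasType (HullCodes.hull C) 0
          (HullCodes.ordSum n b₁ + HullCodes.ordSum n b₂)) ∧
    (∀ b₁ b₂ : ℕ → ℕ,
      (∀ j, j ∣ n → j ∈ HullCodes.N₂ → b₁ j ≤ HullCodes.gam j ∧ b₂ j ≤ HullCodes.gam j) →
      ∃ C : HullCodes.LinearCode n, HullCodes.IsCyclicCode C ∧
        HullCodes.HasType (HullCodes.hull C) 0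
          (HullCodes.ordSum n b₁ + HullCodes.ordSum n b₂)) := by
  constructor
  · intro C hC
    obtain ⟨b₁, b₂, hb, ht⟩ := HullCodes.exists_hasType_hull hodd hn hC
    exact ⟨b₁, b₂, fun j hj _ => hb j hj, ht⟩
  · intro b₁ b₂ hb
    exact HullCodes.exists_isCyclicCode_hasType_hull hodd hn
      (fun j hj => (hb j hj (HullCodes.mem_N₂_of_dvd hn hj)).1)
      (fun j hj => (hb j hj (HullCodes.mem_N₂_of_dvd hn hj)).2)
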